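/- Let $\Omega\subset\mathbb R^3$ be a bounded domain with $C^1$ boundary and outward unit normal $n$, and suppose that $\Omega$ satisfies the uniform circumscribed sphere condition with some radius $R>0$: for every $x\in\partial\Omega$ there is a ball $B_R$ of radius $R$ with $x\in\partial B_R$ and $\overline\Omega\subset\overline{B_R}$. For $x\in\Omega$ and $v\in\mathbb R^3\setminus\{0\}$ put $$\tau_{x,v}:=\inf\{s\ge 0: x-sv\notin\Omega\},\quad q(x,v):=x-\tau_{x,v}v,\quad N(x,v):=-n(q(x,v))\cdot\frac{v}{|v|},\quad w(x,v):=\frac{|v|}{|v|+1}N(x,v).$$ For $\alpha>0$ let $|g|_{\infty,\alpha}:=\operatorname{ess\,sup}_{(x,v)\in\Omega\times\mathbb R^3}e^{\alpha|v|^2}|g(x,v)|$, and let $\hat L^\infty_\alpha$ be the space of functions $f$ on $\Omega\times\mathbb R^3$, with weak gradients $\nabla_xf,\nabla_vf\in L^1_{\rm loc}(\Omega\times\mathbb R^3)$, such that $$|f|_{\infty,\alpha}+|w\nabla_xf|_{\infty,\alpha}+|w\nabla_vf|_{\infty,\alpha}<\infty.$$ Then, for every $\alpha>0$ and every $1\le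 p<3$, $$\hat L^\infty_\alpha\subseteq W^{1,p}(\Omega\times\mathbb R^3).$$ -/

import Mathlib

open MeasureTheory Set Topology
open scoped ContDiff ENNReal

noncomputable section

/-- Physical space (and velocity space) `ℝ³` with the Euclidean norm. -/
abbrev E3 : Type := EuclideanSpace ℝ (Fin 3)

/-- The phase domain `Ω × ℝ³` of pairs `(x, v)`. -/
def phaseDomain (Ω : Set E3) : Set (E3 × E3) := Ω ×ˢ univ

/-! ### Geometry of the space domain -/

/-- `ρ` is a `C¹` local defining function of `Ω` at `z`: it is `C¹` near `z`, vanishes at `z` with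
nonzero gradient, and `Ω = {ρ < 0}` near `z`. -/
structure IsLocalDefiningFunction (Ω : Set E3) (z : E3) (ρ : E3 → ℝ) : Prop where
  contDiffAt : ContDiffAt ℝ 1 ρ z
  map_eq_zero : ρ z = 0
  gradient_ne_zero : gradient ρ z ≠ 0
  mem_iff : ∀ᶠ y in 𝓝 z, (y ∈ Ω ↔ ρ y < 0)

/-- The boundary of `Ω` is of class `C¹`. -/
def HasC1Boundary (Ω : Set E3) : Prop :=
  ∀ z ∈ frontier Ω, ∃ ρ : E3 → ℝ, IsLocalDefiningFunction Ω z ρ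

open Classical in
/-- The outward unit normal `n(z) = ∇ρ(z) / |∇ρ(z)|` at a `C¹` boundary point `z` of `Ω`. It does
not depend on the local defining function `ρ`. (Elsewhere the value is the dummy `0`.) -/
def outwardNormal (Ω : Set E3) (z : E3) : E3 :=
  if h : ∃ ρ : E3 → ℝ, IsLocalDefiningFunction Ω z ρ then
    ‖gradient h.choose z‖⁻¹ • gradient h.choose z
  else 0

/-- The uniform circumscribed sphere condition with radius `R`. -/
def UniformCircumscribedSphere (Ω : Set E3) (R : ℝ) : Prop :=
  0 < R ∧ ∀ x ∈ frontier Ω, ∃ c : E3,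
    x ∈ Metric.sphere c R ∧ closure Ω ⊆ Metric.closedBall c R

/-! ### The backward exit point and the weight -/

/-- `τ_{x,v} = inf {s ≥ 0 : x - s v ∉ Ω}`. -/
def exitTime (Ω : Set E3) (x v : E3) : ℝ := sInf {s : ℝ | 0 ≤ s ∧ x - s • v ∈ Ωᶜ}

/-- `q(x,v) = x - τ_{x,v} v`. -/
def exitPoint (Ω : Set E3) (x v : E3) : E3 := x - exitTime Ω x v • v

/-- `N(x,v) = - n(q(x,v)) · v / |v|`. -/
def exitCosine (Ω : Set E3) (x v : E3) : ℝ :=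
  -inner ℝ (outwardNormal Ω (exitPoint Ω x v)) (‖v‖⁻¹ • v)

/-- `w(x,v) = |v| / (|v| + 1) * N(x,v)`. -/
def kineticWeight (Ω : Set E3) (x v : E3) : ℝ := ‖v‖ / (‖v‖ + 1) * exitCosine Ω x v

/-! ### Weak gradients and function spaces -/

/-- `gx` and `gv` are the weak gradients `∇ₓ f` and `∇ᵥ f` of `f` on the open set `U ⊆ ℝ³ × ℝ³`. -/
structure HasWeakGradients (U : Set (E3 × E3)) (f : E3 × E3 → ℝ) (gx gv : E3 × E3 → E3) :
    Prop where
  locallyIntegrableOn : LocallyIntegrableOn f U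
  locallyIntegrableOn_x : LocallyIntegrableOn gx U
  locallyIntegrableOn_v : LocallyIntegrableOn gv U
  integral_x : ∀ φ : E3 × E3 → ℝ, ContDiff ℝ ∞ φ → HasCompactSupport φ → tsupport φ ⊆ U →
    ∀ i : Fin 3, ∫ z in U, f z * fderiv ℝ φ z (EuclideanSpace.single i 1, 0) =
      -∫ z in U, gx z i * φ z
  integral_v : ∀ φ : E3 × E3 → ℝ, ContDiff ℝ ∞ φ → HasCompactSupport φ → tsupport φ ⊆ U →
    ∀ i : Fin 3, ∫ z in U, f z * fderiv ℝ φ z (0, EuclideanSpace.single i 1) =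
      -∫ z in U, gv z i * φ z

/-- `|g|_{∞,α} = ess sup_{(x,v) ∈ Ω × ℝ³} exp(α |v|²) |g(x,v)|`, with values in `[0,∞]`. -/
def expSupNorm {F : Type*} [NormedAddCommGroup F] (Ω : Set E3) (α : ℝ) (g : E3 × E3 → F) : ℝ≥0∞ :=
  essSup (fun z => ENNReal.ofReal (Real.exp (α * ‖z.2‖ ^ 2) * ‖g z‖))
    (volume.restrict (phaseDomain Ω))

/-- `|g|_{∞,α,w} = |w g|_{∞,α}`. -/
def weightedExpSupNorm (Ω : Set E3) (α : ℝ) (g : E3 × E3 → E3) : ℝ≥0∞ :=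
  expSupNorm Ω α (fun z => kineticWeight Ω z.1 z.2 • g z)

/-- The space `L̂^∞_α` of functions with
`|f|_{∞,α} + |∇ₓ f|_{∞,α,w} + |∇ᵥ f|_{∞,α,w} < ∞`. -/
def hatLInfty (Ω : Set E3) (α : ℝ) : Set (E3 × E3 → ℝ) :=
  {f | ∃ gx gv : E3 × E3 → E3, HasWeakGradients (phaseDomain Ω) f gx gv ∧
    expSupNorm Ω α f + weightedExpSupNorm Ω α gx + weightedExpSupNorm Ω α gv < ⊤}

/-- The Sobolev space `W^{1,p}(U)` for an open set `U ⊆ ℝ³ × ℝ³`. -/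
def sobolevW1 (U : Set (E3 × E3)) (p : ℝ≥0∞) : Set (E3 × E3 → ℝ) :=
  {f | MemLp f p (volume.restrict U) ∧ ∃ gx gv : E3 × E3 → E3, HasWeakGradients U f gx gv ∧
    MemLp gx p (volume.restrict U) ∧ MemLp gv p (volume.restrict U)}

end

/-! Everything reduces to the integrability of `w⁻ᵖ exp(-pα|v|²)`, that is, to measuring the set
where the exit cosine `N` is small. The circumscribed sphere gives `|z - y|² ≤ 2R n(z)·(z - y)` for
`z` in the boundary and `y` in the closure. Hence a backward chord has length at most `2RN`, and
boundary points are `R`-Lipschitz functions of their normals.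

Suppose `N ≤ t`. Cut the sphere of normals into `O(t⁻²)` cells of size `O(t)`, and fix a boundary
point `q` with normal in the same cell as the normal at the exit point. Then `x` lies in a slab at
`q` of width `O(t)` and thickness `O(t²)`, of volume `O(t⁴)`, and `v` lies in the cone `|n(q)·v| ≤
5t|v|`, whose mass for `|v|⁻ᵖ exp(-b|v|²)` is `O(t^γ)` whenever `γ < 1` and `p - 2 < γ`. The total
mass is `O(t^(2+γ))`. Summing `N⁻ᵖ` over dyadic shells of `N` converges for `p < 2 + γ`, which can
be arranged exactly when `p < 3`. Each sublevel set is replaced by an explicit measurable cover, so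
measurability of `N` is never needed. -/

/-! ### Outward normals and the circumscribed sphere -/

/-- A unit vector whose open negative half-space lies in the closed negative half-space of another
unit vector is equal to it. -/
theorem eq_of_forall_inner_neg_imp_inner_nonpos {n m : E3} (hn : ‖n‖ = 1) (hm : ‖m‖ = 1)
    (h : ∀ u : E3, inner ℝ n u < 0 → inner ℝ m u ≤ 0) : n = m := by
  have hnn : inner ℝ n n = 1 := by rw [real_inner_self_eq_norm_sq, hn]; norm_num
  have hmm : inner ℝ m m = 1 := by rw [real_inner_self_eq_norm_sq, hm]; norm_num
  set a : ℝ := inner ℝ n m with ha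
  have ha' : inner ℝ m n = a := real_inner_comm _ _
  have ha0 : 0 ≤ a := by
    have := h (-n) (by rw [inner_neg_right, hnn]; norm_num)
    rw [inner_neg_right, ha'] at this
    linarith
  have ha1 : a ≤ 1 := by simpa [hn, hm] using real_inner_le_norm n m
  -- The test vector `m - (a + ε) n` has inner product `-ε` with `n`.
  have key : ∀ ε : ℝ, 0 < ε → 1 ≤ a ^ 2 + ε := by
    intro ε hε
    have h1 := h (m - (a + ε) • n) (by
      rw [inner_sub_right, inner_smul_right, hnn]; linarith)
    rw [inner_sub_right, inner_smul_right, hmm, ha'] at h1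
    nlinarith
  have h2 : 1 ≤ a ^ 2 := le_of_forall_pos_le_add key
  have h3 : a = 1 := by nlinarith
  exact (inner_eq_one_iff_of_norm_eq_one hn hm).1 h3

/-- A local defining function is negative, and so the set is entered, in every direction that has
a negative inner product with its gradient. -/
theorem IsLocalDefiningFunction.eventually_mem {Ω : Set E3} {z : E3} {ρ : E3 → ℝ}
    (h : IsLocalDefiningFunction Ω z ρ) {u : E3} (hu : inner ℝ (gradient ρ z) u < 0) :
    ∀ᶠ t : ℝ in 𝓝[>] 0, z + t • u ∈ Ω := by
  have hd : HasFDerivAt ρ (fderiv ℝ ρ z) z := (h.contDiffAt.differentiableAt (by simp)).hasFDerivAt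
  have hl : HasDerivAt (fun t : ℝ => z + t • u) u 0 := by
    simpa using ((hasDerivAt_id (0 : ℝ)).smul_const u).const_add z
  have hc : HasDerivAt (fun t : ℝ => ρ (z + t • u)) (fderiv ℝ ρ z u) 0 := by
    have hd' : HasFDerivAt ρ (fderiv ℝ ρ z) (z + (0 : ℝ) • u) := by simpa using hd
    exact hd'.comp_hasDerivAt (0 : ℝ) hl
  have hneg : fderiv ℝ ρ z u < 0 := by
    have : inner ℝ (gradient ρ z) u = fderiv ℝ ρ z u := by
      simp [gradient]
    rwa [← this]
  have hs := (hasDerivAt_iff_tendsto_slope.1 hc).eventually (Iio_mem_nhds hneg)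
  have hs' : ∀ᶠ t : ℝ in 𝓝[>] 0, slope (fun t : ℝ => ρ (z + t • u)) 0 t < 0 :=
    hs.filter_mono (nhdsWithin_mono _ fun t (ht : (0 : ℝ) < t) => ht.ne')
  have hcont : Filter.Tendsto (fun t : ℝ => z + t • u) (𝓝[>] 0) (𝓝 z) := by
    have := hl.continuousAt.tendsto
    simp only [zero_smul, add_zero] at this
    exact this.mono_left nhdsWithin_le_nhds
  filter_upwards [hs', hcont.eventually h.mem_iff, self_mem_nhdsWithin] with t h1 h2 h3
  rw [h2]
  rw [slope_def_field] at h1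
  simp only [zero_smul, add_zero, h.map_eq_zero, sub_zero] at h1
  have h3' : (0 : ℝ) < t := h3
  rcases div_neg_iff.1 h1 with h4 | h4
  · linarith
  · exact h4.1

/-- The outward unit normal at a boundary point points away from the centre of any ball that
contains the set and has that boundary point on its sphere. -/
theorem outwardNormal_eq_of_mem_sphere {Ω : Set E3} (hΩC : HasC1Boundary Ω) {R : ℝ} (hR : 0 < R)
    {z c : E3} (hz : z ∈ frontier Ω) (hc : z ∈ Metric.sphere c R)
    (hΩc : closure Ω ⊆ Metric.closedBall c R) :
    outwardNormal Ω z = R⁻¹ • (z - c) := by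
  have hex := hΩC z hz
  have hρ := hex.choose_spec
  rw [outwardNormal, dif_pos hex]
  set ρ := hex.choose
  have hg : 0 < ‖gradient ρ z‖ := norm_pos_iff.2 hρ.gradient_ne_zero
  have hzc : ‖z - c‖ = R := by simpa [dist_eq_norm] using hc
  apply eq_of_forall_inner_neg_imp_inner_nonpos
  · rw [norm_smul, norm_inv, norm_norm, inv_mul_cancel₀ hg.ne']
  · rw [norm_smul, norm_inv, Real.norm_of_nonneg hR.le, hzc, inv_mul_cancel₀ hR.ne']
  · intro u hu
    have hu' : inner ℝ (gradient ρ z) u < 0 := by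
      rw [real_inner_smul_left] at hu
      exact (pos_iff_neg_of_mul_neg hu).1 (inv_pos.2 hg)
    -- Expand `|z - c + tu|² ≤ R²`, using `|z - c| = R`, and divide by `t`; the limit `t → 0`
    -- follows.
    have h1 : ∀ᶠ t : ℝ in 𝓝[>] 0, inner ℝ (z - c) u ≤ - (t * ‖u‖ ^ 2 / 2) := by
      filter_upwards [hρ.eventually_mem hu', self_mem_nhdsWithin] with t ht ht0
      have ht0 : (0 : ℝ) < t := ht0
      have h2 := hΩc (subset_closure ht)
      rw [Metric.mem_closedBall, dist_eq_norm] at h2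
      have h3 : ‖(z - c) + t • u‖ ^ 2 ≤ R ^ 2 := by
        have : (z - c) + t • u = z + t • u - c := by abel
        rw [this]; gcongr
      rw [norm_add_sq_real, hzc, inner_smul_right, norm_smul, Real.norm_of_nonneg ht0.le] at h3
      have h4 : t * (2 * inner ℝ (z - c) u + t * ‖u‖ ^ 2) ≤ 0 := by nlinarith
      have h5 := nonpos_of_mul_nonpos_right h4 ht0
      linarith
    have h2 : Filter.Tendsto (fun t : ℝ => - (t * ‖u‖ ^ 2 / 2)) (𝓝[>] 0) (𝓝 0) := by
      have : Continuous (fun t : ℝ => - (t * ‖u‖ ^ 2 / 2)) := by fun_prop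
      simpa using (this.tendsto 0).mono_left nhdsWithin_le_nhds
    have h3 : inner ℝ (z - c) u ≤ 0 := ge_of_tendsto h2 h1
    rw [real_inner_smul_left]
    exact mul_nonpos_of_nonneg_of_nonpos (inv_nonneg.2 hR.le) h3

theorem norm_outwardNormal {Ω : Set E3} (hΩC : HasC1Boundary Ω) {R : ℝ}
    (hR : UniformCircumscribedSphere Ω R) {z : E3} (hz : z ∈ frontier Ω) :
    ‖outwardNormal Ω z‖ = 1 := by
  obtain ⟨hR, h⟩ := hR
  obtain ⟨c, hc, hΩc⟩ := h z hz
  have hzc : ‖z - c‖ = R := by simpa [dist_eq_norm] using hc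
  rw [outwardNormal_eq_of_mem_sphere hΩC hR hz hc hΩc, norm_smul, norm_inv,
    Real.norm_of_nonneg hR.le, hzc, inv_mul_cancel₀ hR.ne']

/-- Quantitative strict convexity. -/
theorem sq_norm_sub_le_inner_outwardNormal {Ω : Set E3} (hΩC : HasC1Boundary Ω) {R : ℝ}
    (hR : UniformCircumscribedSphere Ω R) {z y : E3} (hz : z ∈ frontier Ω) (hy : y ∈ closure Ω) :
    ‖z - y‖ ^ 2 ≤ 2 * R * inner ℝ (outwardNormal Ω z) (z - y) := by
  obtain ⟨hR, h⟩ := hR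
  obtain ⟨c, hc, hΩc⟩ := h z hz
  have hzc : ‖z - c‖ = R := by simpa [dist_eq_norm] using hc
  rw [outwardNormal_eq_of_mem_sphere hΩC hR hz hc hΩc, real_inner_smul_left]
  have h2 := hΩc hy
  rw [Metric.mem_closedBall, dist_eq_norm] at h2
  have h3 : ‖(z - c) - (z - y)‖ ^ 2 ≤ R ^ 2 := by
    have : (z - c) - (z - y) = y - c := by abel
    rw [this]; gcongr
  rw [norm_sub_sq_real, hzc] at h3
  have : 2 * R * (R⁻¹ * inner ℝ (z - c) (z - y)) = 2 * inner ℝ (z - c) (z - y) := by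
    field_simp
  rw [this]
  linarith

/-- The inverse of the Gauss map is Lipschitz. -/
theorem norm_sub_le_norm_outwardNormal_sub {Ω : Set E3} (hΩC : HasC1Boundary Ω) {R : ℝ}
    (hR : UniformCircumscribedSphere Ω R) {z y : E3} (hz : z ∈ frontier Ω) (hy : y ∈ frontier Ω) :
    ‖z - y‖ ≤ R * ‖outwardNormal Ω z - outwardNormal Ω y‖ := by
  -- Adding the convexity inequalities based at `z` and at `y` gives `|z - y|² ≤ R (n(z) - n(y))·(z
  -- - y)`; then Cauchy–Schwarz.
  have h1 := sq_norm_sub_le_inner_outwardNormal hΩC hR hz (frontier_subset_closure hy)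
  have h2 := sq_norm_sub_le_inner_outwardNormal hΩC hR hy (frontier_subset_closure hz)
  have h3 := real_inner_le_norm (outwardNormal Ω z - outwardNormal Ω y) (z - y)
  rw [norm_sub_rev y z, ← neg_sub z y, inner_neg_right] at h2
  rw [inner_sub_left] at h3
  have hR0 := hR.1
  rcases (norm_nonneg (z - y)).eq_or_lt with h0 | h0
  · rw [← h0]; positivity
  · have : ‖z - y‖ * ‖z - y‖ ≤ R * ‖outwardNormal Ω z - outwardNormal Ω y‖ * ‖z - y‖ := by
      nlinarith
    exact le_of_mul_le_mul_right this h0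

/-! ### Exit points, chords and grazing velocities -/

/-- A ray leaves a bounded set. -/
theorem exists_nonneg_sub_smul_notMem {Ω : Set E3} (hΩb : Bornology.IsBounded Ω) (x : E3) {v : E3}
    (hv : v ≠ 0) : ∃ s : ℝ, 0 ≤ s ∧ x - s • v ∈ Ωᶜ := by
  obtain ⟨C, hC⟩ := hΩb.exists_norm_le
  have hv' : 0 < ‖v‖ := norm_pos_iff.2 hv
  refine ⟨(|C| + ‖x‖ + 1) / ‖v‖, by positivity, fun hmem => ?_⟩
  have h1 := hC _ hmem
  have h2 : ‖((|C| + ‖x‖ + 1) / ‖v‖) • v‖ = |C| + ‖x‖ + 1 := by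
    rw [norm_smul, Real.norm_of_nonneg (by positivity), div_mul_cancel₀ _ hv'.ne']
  have h3 := norm_sub_norm_le (((|C| + ‖x‖ + 1) / ‖v‖) • v) x
  rw [norm_sub_rev, h2] at h3
  linarith [le_abs_self C]

theorem exitTime_nonneg (Ω : Set E3) (x v : E3) : 0 ≤ exitTime Ω x v :=
  Real.sInf_nonneg fun _ hs => hs.1

theorem exitPoint_notMem {Ω : Set E3} (hΩ : IsOpen Ω) (hΩb : Bornology.IsBounded Ω) (x : E3)
    {v : E3} (hv : v ≠ 0) : exitPoint Ω x v ∉ Ω := by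
  have hcl : IsClosed {s : ℝ | 0 ≤ s ∧ x - s • v ∈ Ωᶜ} :=
    isClosed_Ici.inter (hΩ.isClosed_compl.preimage (f := fun s : ℝ => x - s • v) (by fun_prop))
  exact (hcl.csInf_mem (exists_nonneg_sub_smul_notMem hΩb x hv) ⟨0, fun s hs => hs.1⟩).2

theorem exitTime_pos {Ω : Set E3} (hΩ : IsOpen Ω) (hΩb : Bornology.IsBounded Ω) {x v : E3}
    (hx : x ∈ Ω) (hv : v ≠ 0) : 0 < exitTime Ω x v := by
  refine (exitTime_nonneg Ω x v).lt_of_ne fun h => exitPoint_notMem hΩ hΩb x hv ?_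
  rwa [exitPoint, ← h, zero_smul, sub_zero]

theorem exitPoint_mem_frontier {Ω : Set E3} (hΩ : IsOpen Ω) (hΩb : Bornology.IsBounded Ω)
    {x v : E3} (hx : x ∈ Ω) (hv : v ≠ 0) : exitPoint Ω x v ∈ frontier Ω := by
  rw [hΩ.frontier_eq]
  refine ⟨?_, exitPoint_notMem hΩ hΩb x hv⟩
  have hτ := exitTime_pos hΩ hΩb hx hv
  have h1 : ∀ s ∈ Ico 0 (exitTime Ω x v), x - s • v ∈ Ω := by
    intro s hs
    by_contra hns
    have hmem : s ∈ {s : ℝ | 0 ≤ s ∧ x - s • v ∈ Ωᶜ} := ⟨hs.1, hns⟩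
    exact absurd (csInf_le ⟨0, fun r hr => hr.1⟩ hmem) (not_le.2 hs.2)
  have h2 : Filter.Tendsto (fun s : ℝ => x - s • v) (𝓝[<] exitTime Ω x v)
      (𝓝 (exitPoint Ω x v)) := by
    have : Continuous (fun s : ℝ => x - s • v) := by fun_prop
    exact (this.tendsto _).mono_left nhdsWithin_le_nhds
  refine mem_closure_of_tendsto h2 ?_
  filter_upwards [Ico_mem_nhdsLT hτ] with s hs using h1 s hs

/-- The chord length is controlled by the exit cosine. -/
theorem exitTime_mul_norm_le {Ω : Set E3} (hΩ : IsOpen Ω) (hΩb : Bornology.IsBounded Ω)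
    (hΩC : HasC1Boundary Ω) {R : ℝ} (hR : UniformCircumscribedSphere Ω R) {x v : E3}
    (hx : x ∈ Ω) (hv : v ≠ 0) :
    exitTime Ω x v * ‖v‖ ≤ 2 * R * exitCosine Ω x v := by
  have hτ := exitTime_pos hΩ hΩb hx hv
  have hv' : 0 < ‖v‖ := norm_pos_iff.2 hv
  -- Strict convexity at the exit point, tested against `x`, reads `(τ|v|)² ≤ 2R N τ|v|`.
  have h := sq_norm_sub_le_inner_outwardNormal hΩC hR (exitPoint_mem_frontier hΩ hΩb hx hv)
    (subset_closure hx)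
  have h1 : exitPoint Ω x v - x = -(exitTime Ω x v • v) := by rw [exitPoint]; abel
  rw [h1, norm_neg, norm_smul, Real.norm_of_nonneg hτ.le, inner_neg_right, inner_smul_right] at h
  rw [exitCosine, inner_smul_right]
  set I : ℝ := inner ℝ (outwardNormal Ω (exitPoint Ω x v)) v
  have h2 : exitTime Ω x v * ‖v‖ * (exitTime Ω x v * ‖v‖) ≤
      2 * R * -(‖v‖⁻¹ * I) * (exitTime Ω x v * ‖v‖) := by
    have : 2 * R * -(‖v‖⁻¹ * I) * (exitTime Ω x v * ‖v‖) = 2 * R * -(exitTime Ω x v * I) := by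
      field_simp
    rw [this]
    linarith
  exact le_of_mul_le_mul_right h2 (by positivity)

/-- The chord from an interior point has positive length and is bounded by `2RN`, so grazing exits
are impossible. -/
theorem exitCosine_pos {Ω : Set E3} (hΩ : IsOpen Ω) (hΩb : Bornology.IsBounded Ω)
    (hΩC : HasC1Boundary Ω) {R : ℝ} (hR : UniformCircumscribedSphere Ω R) {x v : E3}
    (hx : x ∈ Ω) (hv : v ≠ 0) : 0 < exitCosine Ω x v := by
  have h1 : 0 < exitTime Ω x v * ‖v‖ := mul_pos (exitTime_pos hΩ hΩb hx hv) (norm_pos_iff.2 hv)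
  have h2 := exitTime_mul_norm_le hΩ hΩb hΩC hR hx hv
  have hR0 := hR.1
  exact pos_of_mul_pos_right (h1.trans_le h2) (by positivity)

theorem exitCosine_le_one {Ω : Set E3} (hΩ : IsOpen Ω) (hΩb : Bornology.IsBounded Ω)
    (hΩC : HasC1Boundary Ω) {R : ℝ} (hR : UniformCircumscribedSphere Ω R) {x v : E3}
    (hx : x ∈ Ω) (hv : v ≠ 0) : exitCosine Ω x v ≤ 1 := by
  have h1 := abs_real_inner_le_norm (outwardNormal Ω (exitPoint Ω x v)) (‖v‖⁻¹ • v)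
  rw [norm_outwardNormal hΩC hR (exitPoint_mem_frontier hΩ hΩb hx hv), norm_smul, norm_inv,
    norm_norm, inv_mul_cancel₀ (norm_ne_zero_iff.2 hv), one_mul] at h1
  exact (neg_le_abs _).trans h1

/-- A point with small exit cosine lies in a thin slab around any boundary point whose normal is
close to the normal at the exit point, and its velocity is nearly tangential there. -/
theorem slab_bounds_of_exitCosine_le {Ω : Set E3} (hΩ : IsOpen Ω) (hΩb : Bornology.IsBounded Ω)
    (hΩC : HasC1Boundary Ω) {R : ℝ} (hR : UniformCircumscribedSphere Ω R) {x v q : E3}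
    (hx : x ∈ Ω) (hv : v ≠ 0) (hq : q ∈ frontier Ω) {t : ℝ} (hN : exitCosine Ω x v ≤ t)
    (hqn : ‖outwardNormal Ω (exitPoint Ω x v) - outwardNormal Ω q‖ ≤ 4 * t) :
    ‖x - q‖ ≤ 6 * R * t ∧ |inner ℝ (outwardNormal Ω q) (x - q)| ≤ 26 * R * t ^ 2 ∧
      |inner ℝ (outwardNormal Ω q) v| ≤ 5 * t * ‖v‖ := by
  have hR0 := hR.1
  have hv' : 0 < ‖v‖ := norm_pos_iff.2 hv
  have hz := exitPoint_mem_frontier hΩ hΩb hx hv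
  have hτ := exitTime_pos hΩ hΩb hx hv
  have hchord := exitTime_mul_norm_le hΩ hΩb hΩC hR hx hv
  have hNpos := exitCosine_pos hΩ hΩb hΩC hR hx hv
  have ht : 0 < t := hNpos.trans_le hN
  set z := exitPoint Ω x v with hzdef
  set n := outwardNormal Ω z
  set m := outwardNormal Ω q
  set τ := exitTime Ω x v
  -- The chord contributes `2Rt` and the inverse Gauss map `4Rt`, whence the `6`; likewise `5 = 1 +
  -- 4` for the velocity and `26 = 10 + 16` for the thickness.
  have hxz : x - q = τ • v + (z - q) := by
    have : z = x - τ • v := rfl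
    rw [this]; abel
  have hτv : τ * ‖v‖ ≤ 2 * R * t := hchord.trans (by gcongr)
  have hzq : ‖z - q‖ ≤ 4 * R * t := by
    have := norm_sub_le_norm_outwardNormal_sub hΩC hR hz hq
    calc ‖z - q‖ ≤ R * ‖n - m‖ := this
      _ ≤ R * (4 * t) := by gcongr
      _ = 4 * R * t := by ring
  have hnv : |inner ℝ n v| ≤ t * ‖v‖ := by
    have h1 : inner ℝ n v = -(exitCosine Ω x v * ‖v‖) := by
      rw [exitCosine, inner_smul_right]
      change inner ℝ n v = -(-(‖v‖⁻¹ * inner ℝ n v) * ‖v‖)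
      field_simp
    rw [h1, abs_neg, abs_of_pos (by positivity)]
    gcongr
  have hmv : |inner ℝ m v| ≤ 5 * t * ‖v‖ := by
    have h1 : inner ℝ m v = inner ℝ n v - inner ℝ (n - m) v := by rw [inner_sub_left]; ring
    have h2 : |inner ℝ (n - m) v| ≤ 4 * t * ‖v‖ :=
      (abs_real_inner_le_norm _ _).trans (by gcongr)
    rw [h1]
    linarith [abs_sub (inner ℝ n v) (inner ℝ (n - m) v)]
  -- The bound is quadratic because `n·(z - q)` and `-m·(z - q)` are both nonnegative, so each is at
  -- most their sum `(n - m)·(z - q) ≤ 4t · 4Rt`.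
  have hmz : |inner ℝ m (z - q)| ≤ 16 * R * t ^ 2 := by
    have h1 := sq_norm_sub_le_inner_outwardNormal hΩC hR hz (frontier_subset_closure hq)
    have h2 := sq_norm_sub_le_inner_outwardNormal hΩC hR hq (frontier_subset_closure hz)
    have h1' : 0 ≤ inner ℝ n (z - q) :=
      nonneg_of_mul_nonneg_right ((sq_nonneg _).trans h1) (by positivity)
    have h2' : 0 ≤ inner ℝ m (q - z) :=
      nonneg_of_mul_nonneg_right ((sq_nonneg _).trans h2) (by positivity)
    rw [← neg_sub z q, inner_neg_right] at h2'
    rw [abs_of_nonpos (by linarith)]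
    have h3 : inner ℝ (n - m) (z - q) ≤ (4 * t) * (4 * R * t) :=
      (real_inner_le_norm _ _).trans (by gcongr)
    rw [inner_sub_left] at h3
    nlinarith
  refine ⟨?_, ?_, hmv⟩
  · rw [hxz]
    refine (norm_add_le _ _).trans ?_
    rw [norm_smul, Real.norm_of_nonneg hτ.le]
    linarith
  · rw [hxz, inner_add_right, inner_smul_right]
    refine (abs_add_le _ _).trans ?_
    rw [abs_mul, abs_of_pos hτ]
    have : τ * |inner ℝ m v| ≤ 10 * R * t ^ 2 := by
      calc τ * |inner ℝ m v| ≤ τ * (5 * t * ‖v‖) := by gcongr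
        _ = 5 * t * (τ * ‖v‖) := by ring
        _ ≤ 5 * t * (2 * R * t) := by gcongr
        _ = 10 * R * t ^ 2 := by ring
    linarith

/-! ### Partition of the sphere of normals -/

/-- Selects a coordinate in which the sphere is a graph of bounded slope over the other two. -/
theorem exists_one_third_le_sq {n : E3} (hn : ‖n‖ = 1) : ∃ j : Fin 3, 1 / 3 ≤ n j ^ 2 := by
  by_contra! h
  have h1 := EuclideanSpace.real_norm_sq_eq n
  rw [hn, Fin.sum_univ_three] at h1
  linarith [h 0, h 1, h 2]

theorem sq_norm_eq_cyclic (u : E3) (j : Fin 3) :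
    ‖u‖ ^ 2 = u j ^ 2 + u (j + 1) ^ 2 + u (j + 2) ^ 2 := by
  rw [EuclideanSpace.real_norm_sq_eq, Fin.sum_univ_three]
  fin_cases j <;> simp <;> ring

/-- Two unit vectors with a common large coordinate of the same sign are close as soon as the other
coordinates are. -/
theorem norm_sub_le_of_coord_close {n m : E3} (hn : ‖n‖ = 1) (hm : ‖m‖ = 1) {j : Fin 3} {δ : ℝ}
    (hnj : 1 / 3 ≤ n j ^ 2) (hmj : 1 / 3 ≤ m j ^ 2) (hsign : 0 ≤ n j ↔ 0 ≤ m j)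
    (h1 : |n (j + 1) - m (j + 1)| ≤ δ) (h2 : |n (j + 2) - m (j + 2)| ≤ δ) :
    ‖n - m‖ ≤ 4 * δ := by
  have hδ : 0 ≤ δ := (abs_nonneg _).trans h1
  have hn2 := sq_norm_eq_cyclic n j
  have hm2 := sq_norm_eq_cyclic m j
  have hd := sq_norm_eq_cyclic (n - m) j
  simp only [PiLp.sub_apply] at hd
  rw [hn] at hn2
  rw [hm] at hm2
  set a := n j
  set b := n (j + 1)
  set c := n (j + 2)
  set a' := m j
  set b' := m (j + 1)
  set c' := m (j + 2)
  have hb : (b - b') ^ 2 ≤ δ ^ 2 := sq_le_sq' (by linarith [abs_le.1 h1]) (abs_le.1 h1).2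
  have hc : (c - c') ^ 2 ≤ δ ^ 2 := sq_le_sq' (by linarith [abs_le.1 h2]) (abs_le.1 h2).2
  have haa : 0 ≤ a * a' := by
    by_cases h : 0 ≤ a
    · exact mul_nonneg h (hsign.1 h)
    · have h' : ¬ 0 ≤ a' := fun h' => h (hsign.2 h')
      exact (mul_pos_of_neg_of_neg (not_le.1 h) (not_le.1 h')).le
  have haa' : 1 / 3 ≤ a * a' := by
    have : (1 / 3) ^ 2 ≤ (a * a') ^ 2 := by
      rw [mul_pow]; nlinarith
    exact le_of_sq_le_sq this haa
  have hs : 4 / 3 ≤ (a + a') ^ 2 := by nlinarith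
  -- Since both vectors are unit, `a² - a'²` is minus the change of `b² + c²`. Dividing by `(a +
  -- a')² ≥ 4/3` gives `(a - a')² ≤ 6δ²`, and `6 + 1 + 1 ≤ 16`.
  have hprod : ((a - a') * (a + a')) ^ 2 ≤ 8 * (2 * δ ^ 2) / 2 := by
    have e1 : (a - a') * (a + a') = -((b - b') * (b + b') + (c - c') * (c + c')) := by
      linarith
    have hcs : ((b - b') * (b + b') + (c - c') * (c + c')) ^ 2 ≤
        ((b - b') ^ 2 + (c - c') ^ 2) * ((b + b') ^ 2 + (c + c') ^ 2) := by
      nlinarith [sq_nonneg ((b - b') * (c + c') - (c - c') * (b + b'))]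
    have hbc : (b + b') ^ 2 + (c + c') ^ 2 ≤ 4 := by
      nlinarith [sq_nonneg (b - b'), sq_nonneg (c - c'), sq_nonneg a, sq_nonneg a']
    rw [e1, neg_sq]
    refine hcs.trans ?_
    have : ((b - b') ^ 2 + (c - c') ^ 2) * ((b + b') ^ 2 + (c + c') ^ 2) ≤ (2 * δ ^ 2) * 4 := by
      gcongr
      linarith
    linarith
  have ha : (a - a') ^ 2 ≤ 6 * δ ^ 2 := by
    rw [mul_pow] at hprod
    nlinarith [sq_nonneg (a - a')]
  have : ‖n - m‖ ^ 2 ≤ (4 * δ) ^ 2 := by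
    rw [hd]; nlinarith
  exact le_of_sq_le_sq this (by positivity)

/-- The unit sphere is divided into `O(K²)` classes of diameter `O(1 / K)`. -/
theorem exists_sphere_partition {K : ℕ} (hK : 0 < K) :
    ∃ (s : Finset (Fin 3 × Bool × ℤ × ℤ)) (κ : E3 → Fin 3 × Bool × ℤ × ℤ),
      s.card ≤ 54 * K ^ 2 ∧ (∀ n, ‖n‖ = 1 → κ n ∈ s) ∧
      ∀ n m, ‖n‖ = 1 → ‖m‖ = 1 → κ n = κ m → ‖n - m‖ ≤ 4 * (1 / K : ℝ) := by
  classical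
  have hK' : (0 : ℝ) < K := by exact_mod_cast hK
  choose! J hJ using fun n : E3 => exists_one_third_le_sq (n := n)
  -- A class records the index of a large coordinate, its sign, and the other two coordinates
  -- rounded to the grid `1/K`. The count is `3 · 2 · (2K + 1)² ≤ 54 K²`.
  refine ⟨Finset.univ ×ˢ Finset.univ ×ˢ Finset.Icc (-(K : ℤ)) K ×ˢ Finset.Icc (-(K : ℤ)) K,
    fun n => (J n, decide (0 ≤ n (J n)), ⌊(K : ℝ) * n (J n + 1)⌋, ⌊(K : ℝ) * n (J n + 2)⌋),
    ?_, ?_, ?_⟩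
  · have h : (Finset.Icc (-(K : ℤ)) K).card = 2 * K + 1 := by
      rw [Int.card_Icc]; omega
    simp only [Finset.card_product, h, Finset.card_univ, Fintype.card_fin, Fintype.card_bool]
    nlinarith
  · intro n hn
    have hcoord : ∀ i : Fin 3, ⌊(K : ℝ) * n i⌋ ∈ Finset.Icc (-(K : ℤ)) K := by
      intro i
      have h1 : |n i| ≤ 1 := by simpa [hn] using PiLp.norm_apply_le n i
      obtain ⟨h2, h3⟩ := abs_le.1 h1
      rw [Finset.mem_Icc]
      constructor
      · rw [Int.le_floor]; push_cast; nlinarith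
      · have : ((⌊(K : ℝ) * n i⌋ : ℤ) : ℝ) ≤ ((K : ℤ) : ℝ) :=
          (Int.floor_le _).trans (by push_cast; nlinarith)
        exact_mod_cast this
    simp only [Finset.mem_product, Finset.mem_univ, true_and]
    exact ⟨hcoord _, hcoord _⟩
  · intro n m hn hm h
    simp only [Prod.mk.injEq, decide_eq_decide] at h
    obtain ⟨hj, hs, h1, h2⟩ := h
    rw [← hj] at hs h1 h2
    have hclose : ∀ i : Fin 3, ⌊(K : ℝ) * n i⌋ = ⌊(K : ℝ) * m i⌋ → |n i - m i| ≤ 1 / K := by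
      intro i hi
      have h3 := (Int.abs_sub_lt_one_of_floor_eq_floor hi).le
      rw [← mul_sub, abs_mul, abs_of_pos hK'] at h3
      rw [le_div_iff₀ hK']
      linarith
    exact norm_sub_le_of_coord_close hn hm (hJ n hn) (hj ▸ hJ m hm) hs (hclose _ h1) (hclose _ h2)

/-! ### Slab volumes and Gaussian integrals over cones -/

/-- Every unit vector can be moved to the first basis vector by a linear isometry. -/
theorem exists_linearIsometryEquiv_inner_eq {n : E3} (hn : ‖n‖ = 1) :
    ∃ A : E3 ≃ₗᵢ[ℝ] E3, ∀ v, inner ℝ n v = A v 0 := by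
  have h : ‖n‖ = ‖(EuclideanSpace.single 0 1 : E3)‖ := by simp [hn]
  -- Reflection in the hyperplane orthogonal to `n - e₀` sends `n` to `e₀`.
  refine ⟨(ℝ ∙ (n - EuclideanSpace.single 0 1))ᗮ.reflection, fun v => ?_⟩
  rw [← LinearIsometryEquiv.inner_map_map (ℝ ∙ (n - EuclideanSpace.single 0 1))ᗮ.reflection n v,
    Submodule.reflection_sub h]
  simp [EuclideanSpace.inner_single_left]

/-- Volume of a ball of radius `r` intersected with a slab of half-width `s`. -/
theorem volume_slab_le {n : E3} (hn : ‖n‖ = 1) (q : E3) {r s : ℝ} (hr : 0 ≤ r) (hs : 0 ≤ s) :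
    volume {x : E3 | ‖x - q‖ ≤ r ∧ |inner ℝ n (x - q)| ≤ s} ≤
      ENNReal.ofReal (8 * s * r ^ 2) := by
  obtain ⟨A, hA⟩ := exists_linearIsometryEquiv_inner_eq hn
  let b : Fin 3 → ℝ := ![s, r, r]
  have hsub : {x : E3 | ‖x - q‖ ≤ r ∧ |inner ℝ n (x - q)| ≤ s} ⊆
      (fun x => WithLp.ofLp (A (x - q))) ⁻¹' (Icc (-b) b) := by
    rintro x ⟨h1, h2⟩
    rw [hA] at h2
    have h3 : ∀ i, |A (x - q) i| ≤ r := fun i => by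
      have := PiLp.norm_apply_le (A (x - q)) i
      rw [A.norm_map] at this
      exact this.trans h1
    have h4 : ∀ i, |A (x - q) i| ≤ b i := by
      intro i
      fin_cases i
      · exact h2
      · exact h3 1
      · exact h3 2
    exact ⟨fun i => (abs_le.1 (h4 i)).1, fun i => (abs_le.1 (h4 i)).2⟩
  have hmp : MeasurePreserving (fun x : E3 => WithLp.ofLp (A (x - q))) :=
    (PiLp.volume_preserving_ofLp (Fin 3)).comp
      (A.measurePreserving.comp (measurePreserving_sub_right volume q))
  refine (measure_mono hsub).trans ?_
  rw [hmp.measure_preimage measurableSet_Icc.nullMeasurableSet, Real.volume_Icc_pi,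
    Fin.prod_univ_three, ← ENNReal.ofReal_mul (by simp [b]; linarith),
    ← ENNReal.ofReal_mul (by simp [b]; nlinarith)]
  apply ENNReal.ofReal_le_ofReal
  simp [b]
  nlinarith

theorem integrable_abs_rpow_mul_exp_neg_mul_sq {b : ℝ} (hb : 0 < b) {s : ℝ} (hs : -1 < s) :
    Integrable fun x : ℝ => |x| ^ s * Real.exp (-b * x ^ 2) := by
  have h := integrableOn_rpow_mul_exp_neg_mul_sq hb hs
  have h1 : IntegrableOn (fun x : ℝ => |x| ^ s * Real.exp (-b * x ^ 2)) (Ioi 0) :=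
    h.congr_fun (fun x (hx : 0 < x) => by simp only [abs_of_pos hx]) measurableSet_Ioi
  rw [← integrableOn_univ, ← @Iio_union_Ici _ _ (0 : ℝ), integrableOn_union,
    integrableOn_Ici_iff_integrableOn_Ioi]
  refine ⟨?_, h1⟩
  rw [← (Measure.measurePreserving_neg (volume : Measure ℝ)).integrableOn_comp_preimage
      (Homeomorph.neg ℝ).measurableEmbedding]
  simpa only [Function.comp_def, neg_sq, abs_neg, neg_preimage, neg_Iio, neg_zero] using h1

/-- The Gaussian integral of `|v|⁻ᵖ` over a conical neighbourhood of a plane, with a bound that is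
uniform in the plane. -/
theorem exists_lintegral_cone_le {b p γ : ℝ} (hb : 0 < b) (hγ0 : 0 < γ) (hγ1 : γ < 1)
    (hγp : p - 2 < γ) (hp : 1 ≤ p) :
    ∃ C : ℝ≥0∞, C < ⊤ ∧ ∀ (n : E3) (ε : ℝ), ‖n‖ = 1 → 0 < ε →
      ∫⁻ v in {v : E3 | |inner ℝ n v| ≤ ε * ‖v‖},
        ENNReal.ofReal (Real.exp (-b * ‖v‖ ^ 2) * ‖v‖ ^ (-p)) ≤ ENNReal.ofReal (ε ^ γ) * C := by
  -- The exponents add up to `-p`. The cone condition trades `|v|^(-γ)` for `ε^γ |v₀|^(-γ)`, and the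
  -- rest is shared by the other two coordinates. One-dimensional integrability at `0` is exactly `γ
  -- < 1` and `p - 2 < γ`.
  let σ : Fin 3 → ℝ := ![-γ, -((p - γ) / 2), -((p - γ) / 2)]
  have hσ : ∀ i, -1 < σ i := by
    intro i
    fin_cases i <;> simp [σ] <;> linarith
  let H : (Fin 3 → ℝ) → ℝ := fun y => ∏ i, (|y i| ^ σ i * Real.exp (-b * y i ^ 2))
  have hH : Integrable H :=
    Integrable.fintype_prod_dep (f := fun i (y : ℝ) => |y| ^ σ i * Real.exp (-b * y ^ 2))
      fun i => integrable_abs_rpow_mul_exp_neg_mul_sq hb (hσ i)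
  have hpt : ∀ (v : E3) (ε : ℝ), 0 < ε → |v 0| ≤ ε * ‖v‖ → (∀ i, v i ≠ 0) →
      Real.exp (-b * ‖v‖ ^ 2) * ‖v‖ ^ (-p) ≤ ε ^ γ * H (WithLp.ofLp v) := by
    intro v ε hε h0 hne
    have hpos : ∀ i, 0 < |v i| := fun i => abs_pos.2 (hne i)
    have hle : ∀ i, |v i| ≤ ‖v‖ := fun i => PiLp.norm_apply_le v i
    have hv : 0 < ‖v‖ := (hpos 0).trans_le (hle 0)
    have hexp : Real.exp (-b * ‖v‖ ^ 2) = Real.exp (-b * v 0 ^ 2) * Real.exp (-b * v 1 ^ 2) *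
        Real.exp (-b * v 2 ^ 2) := by
      rw [← Real.exp_add, ← Real.exp_add, EuclideanSpace.real_norm_sq_eq, Fin.sum_univ_three]
      congr 1; ring
    have h1 : ‖v‖ ^ (-p) = ‖v‖ ^ (-γ) * ‖v‖ ^ (-((p - γ) / 2)) * ‖v‖ ^ (-((p - γ) / 2)) := by
      rw [← Real.rpow_add hv, ← Real.rpow_add hv]; congr 1; ring
    have h2 : ∀ i, ‖v‖ ^ (-((p - γ) / 2)) ≤ |v i| ^ (-((p - γ) / 2)) := fun i =>
      Real.rpow_le_rpow_of_nonpos (hpos i) (hle i) (by linarith)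
    have h3 : ‖v‖ ^ (-γ) ≤ ε ^ γ * |v 0| ^ (-γ) := by
      have h4 : (ε * ‖v‖) ^ (-γ) ≤ |v 0| ^ (-γ) :=
        Real.rpow_le_rpow_of_nonpos (hpos 0) h0 (by linarith)
      rw [Real.mul_rpow hε.le hv.le] at h4
      calc ‖v‖ ^ (-γ) = ε ^ γ * (ε ^ (-γ) * ‖v‖ ^ (-γ)) := by
            rw [← mul_assoc, ← Real.rpow_add hε]; simp
        _ ≤ _ := by gcongr
    have hHv : ε ^ γ * H (WithLp.ofLp v) = Real.exp (-b * ‖v‖ ^ 2) * ((ε ^ γ * |v 0| ^ (-γ)) *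
        |v 1| ^ (-((p - γ) / 2)) * |v 2| ^ (-((p - γ) / 2))) := by
      rw [hexp]
      simp only [H, Fin.prod_univ_three, show σ 0 = -γ from rfl,
        show σ 1 = -((p - γ) / 2) from rfl, show σ 2 = -((p - γ) / 2) from rfl]
      ring
    rw [hHv, h1]
    refine mul_le_mul_of_nonneg_left ?_ (Real.exp_pos _).le
    exact mul_le_mul (mul_le_mul h3 (h2 1) (by positivity) (by positivity)) (h2 2)
      (by positivity) (by positivity)
  refine ⟨∫⁻ y, ENNReal.ofReal (H y), hH.lintegral_lt_top, fun n ε hn hε => ?_⟩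
  obtain ⟨A, hA⟩ := exists_linearIsometryEquiv_inner_eq hn
  have hmp : MeasurePreserving (fun x : E3 => WithLp.ofLp (A x)) :=
    (PiLp.volume_preserving_ofLp (Fin 3)).comp A.measurePreserving
  have hemb : MeasurableEmbedding (fun x : E3 => WithLp.ofLp (A x)) :=
    (MeasurableEquiv.toLp 2 (Fin 3 → ℝ)).symm.measurableEmbedding.comp
      A.toHomeomorph.measurableEmbedding
  -- On the coordinate planes a negative real power of `0` has the default value `0`, and the
  -- pointwise bound may fail.
  have hne : ∀ᵐ v : E3, ∀ i, A v i ≠ 0 := by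
    refine hmp.quasiMeasurePreserving.ae (p := fun y : Fin 3 → ℝ => ∀ i, y i ≠ 0) ?_
    rw [ae_all_iff]
    intro i
    exact (Measure.quasiMeasurePreserving_eval (μ := fun _ : Fin 3 => (volume : Measure ℝ)) i).ae
      (p := fun y : ℝ => y ≠ 0) (Measure.ae_ne volume 0)
  have hmeas : MeasurableSet {v : E3 | |inner ℝ n v| ≤ ε * ‖v‖} :=
    measurableSet_le (by fun_prop) (by fun_prop)
  calc ∫⁻ v in {v : E3 | |inner ℝ n v| ≤ ε * ‖v‖},
        ENNReal.ofReal (Real.exp (-b * ‖v‖ ^ 2) * ‖v‖ ^ (-p))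
      ≤ ∫⁻ v in {v : E3 | |inner ℝ n v| ≤ ε * ‖v‖},
        ENNReal.ofReal (ε ^ γ) * ENNReal.ofReal (H (WithLp.ofLp (A v))) := by
        refine lintegral_mono_ae ?_
        filter_upwards [ae_restrict_mem hmeas, ae_restrict_of_ae hne] with v h1 h2
        rw [← ENNReal.ofReal_mul (by positivity)]
        apply ENNReal.ofReal_le_ofReal
        have := hpt (A v) ε hε (by rw [← hA, A.norm_map]; exact h1) h2
        rwa [A.norm_map] at this
    _ ≤ ∫⁻ v, ENNReal.ofReal (ε ^ γ) * ENNReal.ofReal (H (WithLp.ofLp (A v))) :=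
        setLIntegral_le_lintegral _ _
    _ = ENNReal.ofReal (ε ^ γ) * ∫⁻ y, ENNReal.ofReal (H y) := by
        rw [lintegral_const_mul' _ _ ENNReal.ofReal_ne_top,
          hmp.lintegral_comp_emb hemb (fun y => ENNReal.ofReal (H y))]

theorem setLIntegral_prod_snd {B V : Set E3} {h : E3 → ℝ≥0∞} (hh : Measurable h) :
    ∫⁻ z in B ×ˢ V, h z.2 = volume B * ∫⁻ v in V, h v := by
  have h1 := lintegral_prod_mul (μ := (volume : Measure E3).restrict B)
    (ν := (volume : Measure E3).restrict V) (f := fun _ => 1) (g := h) aemeasurable_const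
    hh.aemeasurable
  rw [Measure.prod_restrict, ← Measure.volume_eq_prod] at h1
  simpa using h1

/-! ### Sublevel sets of the exit cosine -/

/-- The sublevel sets of the exit cosine are small: the set `{N ≤ t}` has weighted measure
`O(t ^ (2 + γ))` for every `γ < 1`. -/
theorem exists_lintegral_exitCosine_sublevel_le {Ω : Set E3} (hΩ : IsOpen Ω)
    (hΩb : Bornology.IsBounded Ω) (hΩC : HasC1Boundary Ω) {R : ℝ}
    (hR : UniformCircumscribedSphere Ω R) {b p γ : ℝ} (hb : 0 < b) (hγ0 : 0 < γ) (hγ1 : γ < 1)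
    (hγp : p - 2 < γ) (hp : 1 ≤ p) :
    ∃ C : ℝ≥0∞, C < ⊤ ∧ ∀ k : ℕ, ∃ T : Set (E3 × E3), MeasurableSet T ∧
      (∀ x ∈ Ω, ∀ v : E3, v ≠ 0 → exitCosine Ω x v ≤ (1 / 2) ^ k → (x, v) ∈ T) ∧
      ∫⁻ z in T, ENNReal.ofReal (Real.exp (-b * ‖z.2‖ ^ 2) * ‖z.2‖ ^ (-p)) ≤
        ENNReal.ofReal (((1 / 2 : ℝ) ^ k) ^ (2 + γ)) * C := by
  obtain ⟨C, hC, hcone⟩ := exists_lintegral_cone_le hb hγ0 hγ1 hγp hp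
  have hR0 := hR.1
  -- The factors come from the number of cells, the slab volume `8 · 26Rt² · (6Rt)²`, and the cone
  -- aperture `5t`; powers of `t` are split off.
  set M : ℝ := 54 * (8 * 26 * 36 * R ^ 3) * 5 ^ γ with hM
  refine ⟨ENNReal.ofReal M * C, ENNReal.mul_lt_top ENNReal.ofReal_lt_top hC, fun k => ?_⟩
  have hK : 0 < 2 ^ k := by positivity
  obtain ⟨s, κ, hcard, hmem, hclose⟩ := exists_sphere_partition hK
  set t : ℝ := (1 / 2) ^ k with ht
  have ht0 : 0 < t := by positivity
  have hKt : (1 / ((2 ^ k : ℕ) : ℝ)) = t := by simp [ht]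
  rw [hKt] at hclose
  have hclass : ∀ i, ∃ D : Set (E3 × E3), MeasurableSet D ∧
      (∀ x ∈ Ω, ∀ v : E3, v ≠ 0 → exitCosine Ω x v ≤ t →
        κ (outwardNormal Ω (exitPoint Ω x v)) = i → (x, v) ∈ D) ∧
      ∫⁻ z in D, ENNReal.ofReal (Real.exp (-b * ‖z.2‖ ^ 2) * ‖z.2‖ ^ (-p)) ≤
        ENNReal.ofReal (8 * (26 * R * t ^ 2) * (6 * R * t) ^ 2 * (5 * t) ^ γ) * C := by
    intro i
    -- The reference point `q` must be a boundary point with normal in the cell; cells that contain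
    -- no boundary normal contribute nothing.
    by_cases hi : ∃ q ∈ frontier Ω, κ (outwardNormal Ω q) = i
    · obtain ⟨q, hq, hqi⟩ := hi
      have hn := norm_outwardNormal hΩC hR hq
      refine ⟨{x | ‖x - q‖ ≤ 6 * R * t ∧ |inner ℝ (outwardNormal Ω q) (x - q)| ≤ 26 * R * t ^ 2} ×ˢ
        {v | |inner ℝ (outwardNormal Ω q) v| ≤ 5 * t * ‖v‖}, ?_, ?_, ?_⟩
      · refine MeasurableSet.prod (measurableSet_setOfPred.2 (Measurable.and ?_ ?_)) ?_
        · exact measurableSet_setOfPred.1 (measurableSet_le (by fun_prop) (by fun_prop))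
        · exact measurableSet_setOfPred.1 (measurableSet_le (by fun_prop) (by fun_prop))
        · exact measurableSet_le (by fun_prop) (by fun_prop)
      · intro x hx v hv hN hκ
        have hz := exitPoint_mem_frontier hΩ hΩb hx hv
        obtain ⟨h1, h2, h3⟩ := slab_bounds_of_exitCosine_le hΩ hΩb hΩC hR hx hv hq hN
          (hclose _ _ (norm_outwardNormal hΩC hR hz) hn (hκ.trans hqi.symm))
        exact ⟨⟨h1, h2⟩, h3⟩
      · rw [setLIntegral_prod_snd (h := fun v : E3 =>
          ENNReal.ofReal (Real.exp (-b * ‖v‖ ^ 2) * ‖v‖ ^ (-p))) (by fun_prop)]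
        calc _ ≤ ENNReal.ofReal (8 * (26 * R * t ^ 2) * (6 * R * t) ^ 2) *
              (ENNReal.ofReal ((5 * t) ^ γ) * C) :=
              mul_le_mul' (volume_slab_le hn q (by positivity) (by positivity))
                (hcone _ _ hn (by positivity))
          _ = _ := by rw [← mul_assoc, ← ENNReal.ofReal_mul (by positivity)]
    · refine ⟨∅, MeasurableSet.empty, fun x hx v hv _ hκ => ?_, by simp⟩
      exact (hi ⟨_, exitPoint_mem_frontier hΩ hΩb hx hv, hκ⟩).elim
  choose D hDm hD hDint using hclass
  refine ⟨⋃ i : s, D i, MeasurableSet.iUnion fun i => hDm i, fun x hx v hv hN => ?_, ?_⟩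
  · exact mem_iUnion.2 ⟨⟨_, hmem _ (norm_outwardNormal hΩC hR
      (exitPoint_mem_frontier hΩ hΩb hx hv))⟩, hD _ x hx v hv hN rfl⟩
  · have hcard' : (s.card : ℝ) ≤ 54 * (t ^ 2)⁻¹ := by
      have : (s.card : ℝ) ≤ ((54 * (2 ^ k) ^ 2 : ℕ) : ℝ) := by exact_mod_cast hcard
      refine this.trans (le_of_eq ?_)
      rw [← hKt]
      push_cast
      field_simp
    calc _ ≤ ∑' i : s, ∫⁻ z in D i,
          ENNReal.ofReal (Real.exp (-b * ‖z.2‖ ^ 2) * ‖z.2‖ ^ (-p)) := lintegral_iUnion_le _ _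
      _ ≤ ∑' _ : s, ENNReal.ofReal (8 * (26 * R * t ^ 2) * (6 * R * t) ^ 2 * (5 * t) ^ γ) * C :=
          ENNReal.tsum_le_tsum fun i => hDint i
      _ = ENNReal.ofReal (s.card) *
          (ENNReal.ofReal (8 * (26 * R * t ^ 2) * (6 * R * t) ^ 2 * (5 * t) ^ γ) * C) := by
          rw [tsum_fintype, Finset.sum_const, Finset.card_univ, Fintype.card_coe, nsmul_eq_mul,
            ENNReal.ofReal_natCast]
      _ = ENNReal.ofReal (s.card * (8 * (26 * R * t ^ 2) * (6 * R * t) ^ 2 * (5 * t) ^ γ)) * C := by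
          rw [← mul_assoc, ← ENNReal.ofReal_mul (by positivity)]
      _ ≤ ENNReal.ofReal (t ^ (2 + γ) * M) * C := by
          refine mul_le_mul_left (ENNReal.ofReal_le_ofReal ?_) C
          calc (s.card : ℝ) * (8 * (26 * R * t ^ 2) * (6 * R * t) ^ 2 * (5 * t) ^ γ)
              ≤ 54 * (t ^ 2)⁻¹ * (8 * (26 * R * t ^ 2) * (6 * R * t) ^ 2 * (5 * t) ^ γ) := by
                gcongr
            _ = t ^ (2 + γ) * M := by
                rw [Real.rpow_add ht0, Real.mul_rpow (by norm_num) ht0.le, Real.rpow_two, hM]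
                field_simp
                ring
      _ = _ := by rw [ENNReal.ofReal_mul (by positivity), mul_assoc]

/-- At `v = 0` and `x ∈ Ω` the exit time is the `sInf` of the empty set, so the exit geometry is
used only off this null set. -/
theorem ae_snd_ne_zero (Ω : Set E3) :
    ∀ᵐ z : E3 × E3 ∂volume.restrict (phaseDomain Ω), z.2 ≠ 0 := by
  refine ae_restrict_of_ae ?_
  exact Measure.quasiMeasurePreserving_snd.ae (p := fun v : E3 => v ≠ 0) (Measure.ae_ne volume 0)

theorem measurableSet_phaseDomain {Ω : Set E3} (hΩ : IsOpen Ω) : MeasurableSet (phaseDomain Ω) :=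
  hΩ.measurableSet.prod MeasurableSet.univ

/-! ### Dyadic summation and the embedding -/

/-- Integrability of the inverse powers of the weight below the critical exponent. -/
theorem lintegral_exp_mul_rpow_exitCosine_lt_top {Ω : Set E3} (hΩ : IsOpen Ω)
    (hΩb : Bornology.IsBounded Ω) (hΩC : HasC1Boundary Ω) {R : ℝ}
    (hR : UniformCircumscribedSphere Ω R) {b p : ℝ} (hb : 0 < b) (hp : 1 ≤ p) (hp3 : p < 3) :
    ∫⁻ z in phaseDomain Ω, ENNReal.ofReal (Real.exp (-b * ‖z.2‖ ^ 2) * ‖z.2‖ ^ (-p) *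
      exitCosine Ω z.1 z.2 ^ (-p)) < ⊤ := by
  -- For `1 ≤ p < 3` the choice `γ = p / 3` satisfies both `γ < 1` and `p - 2 < γ`.
  obtain ⟨C, hC, hT⟩ := exists_lintegral_exitCosine_sublevel_le hΩ hΩb hΩC hR (b := b) (p := p)
    (γ := p / 3) hb (by linarith) (by linarith) (by linarith) hp
  choose T hTm hTmem hTint using hT
  set h : E3 × E3 → ℝ≥0∞ :=
    fun z => ENNReal.ofReal (Real.exp (-b * ‖z.2‖ ^ 2) * ‖z.2‖ ^ (-p)) with hh
  have hhm : Measurable h := by fun_prop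
  have hpt : ∀ᵐ z : E3 × E3 ∂volume.restrict (phaseDomain Ω),
      ENNReal.ofReal (Real.exp (-b * ‖z.2‖ ^ 2) * ‖z.2‖ ^ (-p) * exitCosine Ω z.1 z.2 ^ (-p)) ≤
        ∑' k : ℕ, (T k).indicator (fun z => ENNReal.ofReal (((1 / 2 : ℝ) ^ (k + 1)) ^ (-p)) * h z)
          z := by
    filter_upwards [ae_restrict_mem (measurableSet_phaseDomain hΩ), ae_snd_ne_zero Ω] with z hz hv
    have hx : z.1 ∈ Ω := hz.1
    have hN := exitCosine_pos hΩ hΩb hΩC hR hx hv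
    -- Dyadic shell `(1/2)^(k+1) < N ≤ (1/2)^k`: the upper bound places `z` in `T k`, the lower one
    -- bounds `N⁻ᵖ`.
    obtain ⟨k, hk1, hk2⟩ := exists_nat_pow_near_of_lt_one hN (exitCosine_le_one hΩ hΩb hΩC hR hx hv)
      (by norm_num : (0 : ℝ) < 1 / 2) (by norm_num)
    refine le_trans ?_ (ENNReal.le_tsum k)
    rw [indicator_of_mem (show z ∈ T k from hTmem k z.1 hx z.2 hv hk2), hh,
      ← ENNReal.ofReal_mul (by positivity), mul_comm]
    apply ENNReal.ofReal_le_ofReal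
    gcongr ?_ * _
    exact Real.rpow_le_rpow_of_nonpos (by positivity) hk1.le (by linarith)
  have hr : (2 : ℝ) ^ (p - 2 - p / 3) < 1 :=
    Real.rpow_lt_one_of_one_lt_of_neg (by norm_num) (by linarith)
  have hterm : ∀ k : ℕ, ((1 / 2 : ℝ) ^ (k + 1)) ^ (-p) * ((1 / 2 : ℝ) ^ k) ^ (2 + p / 3) =
      2 ^ p * ((2 : ℝ) ^ (p - 2 - p / 3)) ^ k := by
    intro k
    have h2 : ∀ (m : ℕ) (a : ℝ), ((1 / 2 : ℝ) ^ m) ^ a = (2 : ℝ) ^ (-(m * a)) := by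
      intro m a
      rw [one_div, inv_pow, ← Real.rpow_natCast, ← Real.rpow_neg (by norm_num),
        ← Real.rpow_mul (by norm_num), neg_mul]
    rw [h2, h2, ← Real.rpow_natCast, ← Real.rpow_mul (by norm_num), ← Real.rpow_add (by norm_num),
      ← Real.rpow_add (by norm_num)]
    congr 1
    push_cast
    ring
  calc _ ≤ ∫⁻ z in phaseDomain Ω, ∑' k : ℕ, (T k).indicator
          (fun z => ENNReal.ofReal (((1 / 2 : ℝ) ^ (k + 1)) ^ (-p)) * h z) z :=
        lintegral_mono_ae hpt
    _ ≤ ∫⁻ z, ∑' k : ℕ, (T k).indicator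
          (fun z => ENNReal.ofReal (((1 / 2 : ℝ) ^ (k + 1)) ^ (-p)) * h z) z :=
        setLIntegral_le_lintegral _ _
    _ = ∑' k : ℕ, ENNReal.ofReal (((1 / 2 : ℝ) ^ (k + 1)) ^ (-p)) * ∫⁻ z in T k, h z := by
        rw [lintegral_tsum fun k => ((hhm.const_mul _).indicator (hTm k)).aemeasurable]
        refine tsum_congr fun k => ?_
        rw [lintegral_indicator (hTm k), lintegral_const_mul _ hhm]
    _ ≤ ∑' k : ℕ, ENNReal.ofReal (2 ^ p * ((2 : ℝ) ^ (p - 2 - p / 3)) ^ k) * C := by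
        refine ENNReal.tsum_le_tsum fun k => ?_
        rw [← hterm, ENNReal.ofReal_mul (by positivity), mul_assoc]
        gcongr
        exact hTint k
    _ < ⊤ := by
        rw [ENNReal.tsum_mul_right]
        refine ENNReal.mul_lt_top ?_ hC
        exact ((summable_geometric_of_lt_one (by positivity) hr).mul_left _).tsum_ofReal_lt_top

/-- Half of the Gaussian absorbs the factor `1 + |v|` of `1/w`; the other half remains for
integration. -/
theorem one_add_le_mul_exp {α : ℝ} (hα : 0 < α) (r : ℝ) :
    1 + r ≤ (2 + 2 / α) * Real.exp (α / 2 * r ^ 2) := by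
  have h1 := Real.add_one_le_exp (α / 2 * r ^ 2)
  have h2 : (2 + 2 / α) * (α / 2 * r ^ 2 + 1) = 2 + α * r ^ 2 + r ^ 2 + 2 / α := by
    field_simp
    ring
  have h3 : 0 < 2 / α := by positivity
  have h4 : (2 + 2 / α) * (α / 2 * r ^ 2 + 1) ≤ (2 + 2 / α) * Real.exp (α / 2 * r ^ 2) := by
    gcongr
  nlinarith [sq_nonneg (r - 1), mul_nonneg hα.le (sq_nonneg r)]

/-- A function with finite weighted norm lies in `Lᵖ` for every `p < 3`. -/
theorem memLp_of_expSupNorm_kineticWeight_smul_lt_top {F : Type*} [NormedAddCommGroup F]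
    [NormedSpace ℝ F] {Ω : Set E3} (hΩ : IsOpen Ω) (hΩb : Bornology.IsBounded Ω)
    (hΩC : HasC1Boundary Ω) {R : ℝ} (hR : UniformCircumscribedSphere Ω R) {α : ℝ} (hα : 0 < α)
    {p : ℝ≥0∞} (hp1 : 1 ≤ p) (hp3 : p < 3) {g : E3 × E3 → F}
    (hgm : AEStronglyMeasurable g (volume.restrict (phaseDomain Ω)))
    (hg : expSupNorm Ω α (fun z => kineticWeight Ω z.1 z.2 • g z) < ⊤) :
    MemLp g p (volume.restrict (phaseDomain Ω)) := by
  have hptop : p ≠ ⊤ := (hp3.trans_le le_top).ne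
  have hp0 : p ≠ 0 := (zero_lt_one.trans_le hp1).ne'
  have hq1 : 1 ≤ p.toReal := by simpa using ENNReal.toReal_mono hptop hp1
  have hq3 : p.toReal < 3 := by simpa using ENNReal.toReal_strict_mono (by simp) hp3
  refine ⟨hgm, (eLpNorm_lt_top_iff_lintegral_rpow_enorm_lt_top hp0 hptop).2 ?_⟩
  set q := p.toReal
  set S := (expSupNorm Ω α (fun z => kineticWeight Ω z.1 z.2 • g z)).toReal with hS
  have hS0 : 0 ≤ S := ENNReal.toReal_nonneg
  set M : ℝ := S * (2 + 2 / α) with hM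
  have hM0 : 0 ≤ M := by positivity
  have hbound : ∀ᵐ z : E3 × E3 ∂volume.restrict (phaseDomain Ω),
      ‖g z‖ ≤ M * (Real.exp (-(α / 2) * ‖z.2‖ ^ 2) * ‖z.2‖⁻¹ * (exitCosine Ω z.1 z.2)⁻¹) := by
    filter_upwards [ENNReal.ae_le_essSup (μ := volume.restrict (phaseDomain Ω))
      (fun z => ENNReal.ofReal (Real.exp (α * ‖z.2‖ ^ 2) * ‖kineticWeight Ω z.1 z.2 • g z‖)),
      ae_restrict_mem (measurableSet_phaseDomain hΩ), ae_snd_ne_zero Ω] with z h1 hz hv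
    have hN := exitCosine_pos hΩ hΩb hΩC hR hz.1 hv
    have hv' : 0 < ‖z.2‖ := norm_pos_iff.2 hv
    have h2 : Real.exp (α * ‖z.2‖ ^ 2) * ‖kineticWeight Ω z.1 z.2 • g z‖ ≤ S :=
      (ENNReal.ofReal_le_iff_le_toReal hg.ne).1 h1
    rw [norm_smul, kineticWeight, Real.norm_of_nonneg (by positivity)] at h2
    have h3 := one_add_le_mul_exp hα ‖z.2‖
    set r := ‖z.2‖
    set N := exitCosine Ω z.1 z.2
    have he : Real.exp (α * r ^ 2) = Real.exp (α / 2 * r ^ 2) * Real.exp (α / 2 * r ^ 2) := by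
      rw [← Real.exp_add]; congr 1; ring
    have he' : Real.exp (-(α / 2) * r ^ 2) = (Real.exp (α / 2 * r ^ 2))⁻¹ := by
      rw [← Real.exp_neg]; congr 1; ring
    rw [he']
    rw [he] at h2
    set e := Real.exp (α / 2 * r ^ 2)
    have hepos : 0 < e := Real.exp_pos _
    have h4 : e * e * (r * N) * ‖g z‖ ≤ S * (1 + r) := by
      have : e * e * (r / (r + 1) * N * ‖g z‖) * (1 + r) = e * e * (r * N) * ‖g z‖ := by
        field_simp
        ring
      rw [← this]
      gcongr
    have h5 : e * e * (r * N) * ‖g z‖ ≤ M * e := by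
      refine h4.trans ?_
      rw [hM, mul_assoc]
      gcongr
    have h6 : M * (e⁻¹ * r⁻¹ * N⁻¹) = M * e / (e * e * (r * N)) := by
      field_simp
    rw [h6, le_div_iff₀ (by positivity)]
    linarith
  have hpow : ∀ᵐ z : E3 × E3 ∂volume.restrict (phaseDomain Ω),
      ‖g z‖ₑ ^ q ≤ ENNReal.ofReal (M ^ q) *
        ENNReal.ofReal (Real.exp (-(α / 2 * q) * ‖z.2‖ ^ 2) * ‖z.2‖ ^ (-q) *
          exitCosine Ω z.1 z.2 ^ (-q)) := by
    filter_upwards [hbound, ae_restrict_mem (measurableSet_phaseDomain hΩ), ae_snd_ne_zero Ω]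
      with z h1 hz hv
    have hN := exitCosine_pos hΩ hΩb hΩC hR hz.1 hv
    rw [← ofReal_norm, ENNReal.ofReal_rpow_of_nonneg (norm_nonneg _) (by linarith),
      ← ENNReal.ofReal_mul (by positivity)]
    apply ENNReal.ofReal_le_ofReal
    refine (Real.rpow_le_rpow (norm_nonneg _) h1 (by linarith)).trans (le_of_eq ?_)
    have hr0 : 0 ≤ ‖z.2‖⁻¹ := by positivity
    have he0 := (Real.exp_pos (-(α / 2) * ‖z.2‖ ^ 2)).le
    rw [Real.mul_rpow hM0 (by positivity), Real.mul_rpow (mul_nonneg he0 hr0) (by positivity),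
      Real.mul_rpow he0 hr0, ← Real.exp_mul,
      Real.inv_rpow (norm_nonneg _), Real.inv_rpow hN.le, Real.rpow_neg (norm_nonneg _),
      Real.rpow_neg hN.le]
    congr 4
    ring
  refine (lintegral_mono_ae hpow).trans_lt ?_
  rw [lintegral_const_mul' _ _ ENNReal.ofReal_ne_top]
  exact ENNReal.mul_lt_top ENNReal.ofReal_lt_top
    (lintegral_exp_mul_rpow_exitCosine_lt_top hΩ hΩb hΩC hR (by positivity) hq1 hq3)

/-- The weight is at most one, so the weighted norm is dominated by the unweighted one. -/
theorem expSupNorm_kineticWeight_smul_le {F : Type*} [NormedAddCommGroup F] [NormedSpace ℝ F]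
    {Ω : Set E3} (hΩ : IsOpen Ω) (hΩb : Bornology.IsBounded Ω) (hΩC : HasC1Boundary Ω) {R : ℝ}
    (hR : UniformCircumscribedSphere Ω R) (α : ℝ) (g : E3 × E3 → F) :
    expSupNorm Ω α (fun z => kineticWeight Ω z.1 z.2 • g z) ≤ expSupNorm Ω α g := by
  refine essSup_mono_ae ?_
  filter_upwards [ae_restrict_mem (measurableSet_phaseDomain hΩ), ae_snd_ne_zero Ω] with z hz hv
  have hN := exitCosine_pos hΩ hΩb hΩC hR hz.1 hv
  have hN1 := exitCosine_le_one hΩ hΩb hΩC hR hz.1 hv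
  have hw : kineticWeight Ω z.1 z.2 ≤ 1 := by
    rw [kineticWeight]
    exact mul_le_one₀ (div_le_one_of_le₀ (by linarith) (by positivity)) hN.le hN1
  have hw0 : 0 ≤ kineticWeight Ω z.1 z.2 := by rw [kineticWeight]; positivity
  apply ENNReal.ofReal_le_ofReal
  rw [norm_smul, Real.norm_of_nonneg hw0]
  gcongr
  exact mul_le_of_le_one_left (norm_nonneg _) hw

theorem mainTheorem5 (Ω : Set E3) (hΩ : IsOpen Ω) (hΩb : Bornology.IsBounded Ω)
    (hΩC : HasC1Boundary Ω) (R : ℝ) (hR : UniformCircumscribedSphere Ω R)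
    (α : ℝ) (hα : 0 < α) (p : ℝ≥0∞) (hp1 : 1 ≤ p) (hp3 : p < 3) :
    hatLInfty Ω α ⊆ sobolevW1 (phaseDomain Ω) p := by
  rintro f ⟨gx, gv, hw, hnorm⟩
  simp only [ENNReal.add_lt_top] at hnorm
  obtain ⟨⟨hf, hgx⟩, hgv⟩ := hnorm
  -- Since `w ≤ 1`, the unweighted bound on `f` implies a weighted one, so one criterion serves `f`
  -- and both gradients.
  exact ⟨memLp_of_expSupNorm_kineticWeight_smul_lt_top hΩ hΩb hΩC hR hα hp1 hp3
      hw.locallyIntegrableOn.aestronglyMeasurable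
      ((expSupNorm_kineticWeight_smul_le hΩ hΩb hΩC hR α f).trans_lt hf),
    gx, gv, hw,
    memLp_of_expSupNorm_kineticWeight_smul_lt_top hΩ hΩb hΩC hR hα hp1 hp3
      hw.locallyIntegrableOn_x.aestronglyMeasurable hgx,
    memLp_of_expSupNorm_kineticWeight_smul_lt_top hΩ hΩb hΩC hR hα hp1 hp3
      hw.locallyIntegrableOn_v.aestronglyMeasurable hgv⟩
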